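/- **Definitions.** Let $P$ be a finite pointed poset, i.e. a finite poset with a least element $*$. A vertex of $x\in P$ is an element $v\le x$ with $v\neq *$ such that $y<v$ implies $y=*$; let $V(x)$ be the set of vertices of $x$. Call $P$ *polyhedral* if for every $x\in P$ any two elements of $P_{\le x}=\{y\in P: y\le x\}$ have a greatest lower bound in $P_{\le x}$, and *regular* if $P_{\le x}\cong P_{\le y}$ (as posets) whenever $|V(x)|=|V(y)|$. Put $\|P\|=\max_{x}|V(x)|-1$, and for $i\ge -1$ let $f_i(P)$ be the number of $x\in P$ with $|V(x)|=i+1$ (so $f_{-1}(P)=1$). The *simplicial transform* $s(P)$ has as objects the classes $[x,S]$ of pairs $(x,S)$, $x\in P$, $S\subseteq V(x)$, under the equivalence relation generated by $(x,S)\sim(y,S)$ whenever $x$ and $y$ have a minimal upper bound. For a regular $P$ and $1\le i<k$ let $\nu_{i,k}(P)$ be the number of objects $[x,S]$ of $s(P_{\le x})$ with $|S|=i+1$ for which there is no $y<x$ with $S\subseteq V(y)$, where $x\in P$ is any element with $|V(x)|=k+1$ (the number does not depend on $x$; if there is no such $x$ then $f_k(P)=0$ and the value is irrelevant). Put $\nu_{i,k}(P)=0$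 for $i\in\{-1,0\}$ and $k>i$. Let $\Bbbk$ be a nonzero commutative ring. The *Stanley–Reisner ring* of $P$ is the polyhedral tensor product of the augmentations $\Bbbk[v]\to\Bbbk$, that is, the limit $$\Bbbk[P]=\lim_{x\in P^{\mathrm{op}}}\Bbbk[V(x)]=\Big\{(u_x)_x\in\prod_{x\in P}\Bbbk[V(x)] : u_y|_{x}=u_x\text{ for all }x\le y\Big\},$$ where $\Bbbk[V(x)]$ is the polynomial ring on the set $V(x)$ and, for $x\le y$, $u\mapsto u|_x$ is the $\Bbbk$-algebra map $\Bbbk[V(y)]\to\Bbbk[V(x)]$ that fixes the variables in $V(x)$ and sends those in $V(y)\setminus V(x)$ to $0$. Let $\Bbbk[P]_n\subseteq\Bbbk[P]$ be the submodule of the families $(u_x)_x$ with every $u_x$ homogeneous of degree $n$ (every vertex having degree $1$). **Proposition.** Let $P$ be a finite regular polyhedral poset and $\Bbbk$ a nonzero commutative ring. Then $\Bbbk[P]=\bigoplus_{n\ge0}\Bbbk[P]_n$ is a graded $\Bbbk$-algebra, in which each $x\in P$ determines an element of degree $|V(x)|$, namely the family whose component at $y$ is $\prod_{v\in V(x)}v$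 if $x\le y$ and $0$ otherwise. Each $\Bbbk[P]_n$ is a free $\Bbbk$-module of finite rank, and the Poincaré series $P_{\Bbbk[P]}(t)=\sum_{n\ge0}\operatorname{rank}_{\Bbbk}(\Bbbk[P]_n)\,t^n$ is $$P_{\Bbbk[P]}(t)=\sum_{i=-1}^{\|P\|}\Big(f_i(P)+\sum_{k=i+1}^{\|P\|}f_k(P)\,\nu_{i,k}(P)\Big)\frac{t^{i+1}}{(1-t)^{i+1}}$$ (the terms with $i>\|P\|$ vanish, so the sum may equally be taken over all $i\ge-1$). -/

import Mathlib

noncomputable section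

namespace PolyhedralPoset

section Posets

/-! A finite pointed poset is a finite partial order with a least element `⊥` (the base point). -/

/-- The set `V(x)` of vertices of `x`: the minimal non-base-point elements below `x`. -/
def vertexSet {P : Type*} [PartialOrder P] [OrderBot P] (x : P) : Set P :=
  {v | IsAtom v ∧ v ≤ x}

/-- `|V(x)|`. -/
def numVertices {P : Type*} [PartialOrder P] [OrderBot P] (x : P) : ℕ :=
  (vertexSet x).ncard

/-- `[∨ S]`: the set of minimal upper bounds of `S`. -/
def minimalUpperBounds {P : Type*} [PartialOrder P] (S : Set P) : Set P :=
  {z | Minimal (fun w => w ∈ upperBounds S) z}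

/-- Polyhedral: every principal down-set `P_{≤ x}` is a lower semilattice. -/
def IsPolyhedral (P : Type*) [PartialOrder P] [OrderBot P] : Prop :=
  ∀ x : P, ∀ a b : Set.Iic x, ∃ m : Set.Iic x, IsGLB {a, b} m

/-- Regular: `P_{≤ x} ≅ P_{≤ y}` whenever `|V(x)| = |V(y)|`. -/
def IsRegular (P : Type*) [PartialOrder P] [OrderBot P] : Prop :=
  ∀ x y : P, numVertices x = numVertices y → Nonempty (Set.Iic x ≃o Set.Iic y)

/-- `‖P‖ = max_x |V(x)| - 1`, an integer `≥ -1`. -/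
def dim (P : Type*) [PartialOrder P] [OrderBot P] : ℤ :=
  ((⨆ x : P, numVertices x : ℕ) : ℤ) - 1

/-- `f_i(P)`: the number of objects with exactly `i + 1` vertices. -/
def fNumber (P : Type*) [PartialOrder P] [OrderBot P] (i : ℤ) : ℕ :=
  Nat.card {x : P // (numVertices x : ℤ) = i + 1}

/-- The pairs `(x, S)` with `S ⊆ V(x)`. -/
def FacePair (P : Type*) [PartialOrder P] [OrderBot P] : Type _ :=
  {p : P × Set P // p.2 ⊆ vertexSet p.1}

/-- `(x, S) ∼ (y, T)` if `S = T` and `x`, `y` have a minimal upper bound. -/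
def FacePair.Rel {P : Type*} [PartialOrder P] [OrderBot P] (p q : FacePair P) : Prop :=
  p.1.2 = q.1.2 ∧ (minimalUpperBounds {p.1.1, q.1.1}).Nonempty

/-- The objects of the simplicial transform `s(P)`: the classes `[x, S]` for the equivalence
relation generated by `FacePair.Rel`. -/
def SimplicialTransform (P : Type*) [PartialOrder P] [OrderBot P] : Type _ :=
  Quot (FacePair.Rel (P := P))

/-- The class `[x, S]`. -/
def SimplicialTransform.mk {P : Type*} [PartialOrder P] [OrderBot P]
    (x : P) (S : Set P) (hS : S ⊆ vertexSet x) : SimplicialTransform P :=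
  Quot.mk _ ⟨(x, S), hS⟩

/-- The number of objects `[x, S]` of `s(P_{≤ x})` with `|S| = i + 1` such that there is no
`y < x` with `S ⊆ V(y)`. Here `⊤` is `x`, seen as the top element of `P_{≤ x}`. -/
def nuAt {P : Type*} [PartialOrder P] [OrderBot P] (x : P) (i : ℤ) : ℕ :=
  Nat.card {c : SimplicialTransform (Set.Iic x) //
    ∃ (S : Set (Set.Iic x)) (hS : S ⊆ vertexSet (⊤ : Set.Iic x)),
      c = SimplicialTransform.mk ⊤ S hS ∧ (S.ncard : ℤ) = i + 1 ∧
        ¬ ∃ y : Set.Iic x, y < ⊤ ∧ S ⊆ vertexSet y}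

open scoped Classical in
/-- `ν_{i,k}(P)`: for `1 ≤ i < k` the number `nuAt x i` for an object `x` with `k + 1` vertices
(in a regular poset the choice of `x` does not matter), and `0` if `i ≤ 0`. It only occurs
multiplied by `f_k(P)`, so its value when no such `x` exists is immaterial. -/
def nu (P : Type*) [PartialOrder P] [OrderBot P] (i k : ℤ) : ℕ :=
  if h : 1 ≤ i ∧ i < k ∧ ∃ x : P, (numVertices x : ℤ) = k + 1 then nuAt h.2.2.choose i else 0

end Posets

section FaceRing

open scoped Classical in
/-- For `x ≤ y`, the map `k[V(y)] → k[V(x)]` that fixes the variables in `V(x)` and sends the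
other variables to `0` (i.e. the tensor product over the vertices of identities and of
augmentations `k[v] → k`). -/
def restrict (k : Type*) [CommRing k] {P : Type*} [PartialOrder P] [OrderBot P] (x y : P) :
    MvPolynomial (vertexSet y) k →ₐ[k] MvPolynomial (vertexSet x) k :=
  MvPolynomial.aeval fun v => if hv : (v : P) ∈ vertexSet x then MvPolynomial.X ⟨v, hv⟩ else 0

/-- The Stanley-Reisner ring `k[P]`: the limit over `Pᵒᵖ` of the polynomial rings `k[V(x)]`
along the maps `restrict`, i.e. the polyhedral tensor product of the augmentations `k[v] → k`. -/
def stanleyReisner (k : Type*) [CommRing k] (P : Type*) [PartialOrder P] [OrderBot P] :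
    Subalgebra k ((x : P) → MvPolynomial (vertexSet x) k) where
  carrier := {u | ∀ x y : P, x ≤ y → restrict k x y (u y) = u x}
  mul_mem' := by
    intro a b ha hb x y h
    simp [ha x y h, hb x y h]
  add_mem' := by
    intro a b ha hb x y h
    simp [ha x y h, hb x y h]
  algebraMap_mem' := by
    intro r x y h
    simp

/-- The degree `n` part of `k[P]`: the families of homogeneous polynomials of degree `n`. -/
def degreePart (k : Type*) [CommRing k] (P : Type*) [PartialOrder P] [OrderBot P] (n : ℕ) :
    Submodule k (stanleyReisner k P) where
  carrier := {u | ∀ x : P, (u.1 x).IsHomogeneous n}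
  add_mem' := by
    intro a b ha hb x
    exact (ha x).add (hb x)
  zero_mem' := by
    intro x
    exact MvPolynomial.isHomogeneous_zero _ _ _
  smul_mem' := by
    intro c u hu x
    exact (MvPolynomial.homogeneousSubmodule _ k n).smul_mem c (hu x)

open scoped Classical in
/-- The family representing an object `x`: at `y` it is `∏_{v ∈ V(x)} v` if `x ≤ y`, and `0`
otherwise. -/
def objectFamily (k : Type*) [CommRing k] {P : Type*} [PartialOrder P] [OrderBot P] (x : P) :
    (y : P) → MvPolynomial (vertexSet y) k :=
  fun y => if h : x ≤ y then
    ∏ᶠ v : vertexSet x, MvPolynomial.X (⟨v.1, v.2.1, v.2.2.trans h⟩ : vertexSet y) else 0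

/-- The Poincaré series `∑ₙ rank(k[P]ₙ) tⁿ`. -/
def poincareSeries (k : Type*) [CommRing k] (P : Type*) [PartialOrder P] [OrderBot P] :
    PowerSeries ℚ :=
  PowerSeries.mk fun n => (Module.finrank k (degreePart k P n) : ℚ)

end FaceRing

end PolyhedralPoset

end

/-! Say that `y` carries `S` if `y` is minimal among the objects whose vertex sets contain `S`.
Meets inside `P_{≤ x}` show that every `S ⊆ V(x)` has exactly one carrier below `x`. A family in
`k[P]` is therefore determined by its coefficients at the pairs `(y, m)` where `y` carries the
support of the monomial `m`: the coefficient of `u_x` at `m` is that of `u_y` for the carrier `y ≤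
x`. These coefficients are arbitrary, because the family equal to `m` above `y` and to `0` elsewhere
is compatible. So the pairs of degree `n` index a basis of `k[P]_n` (`carriedCoeff_injective`,
`carriedCoeff_surjective`).

For the series, the monomials with support exactly `S` contribute `(t/(1-t))^|S|`, and it remains to
count the sets of size `i + 1` carried by each `y`. By regularity the count depends only on `|V(y)|
= j + 1`: it is `1` if `j = i`, `ν_{i,j}` if `j > i`, and `0` if `j < i` (`sum_carriedCard`). -/

namespace PolyhedralPoset

/-! ### Carriers of vertex sets, and their number. -/

section Carriers

variable {P : Type*} [PartialOrder P] [OrderBot P]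

/-- `y` is minimal among the objects whose vertex set contains `S`. -/
def Carries (y : P) (S : Set P) : Prop :=
  S ⊆ vertexSet y ∧ ∀ z < y, ¬ S ⊆ vertexSet z

theorem vertexSet_mono {x y : P} (h : x ≤ y) : vertexSet x ⊆ vertexSet y :=
  fun _ hv => ⟨hv.1, hv.2.trans h⟩

theorem IsPolyhedral.exists_inf (hpoly : IsPolyhedral P) {x a b : P} (ha : a ≤ x) (hb : b ≤ x) :
    ∃ m : P, m ≤ a ∧ m ≤ b ∧ ∀ c, c ≤ a → c ≤ b → c ≤ m := by
  obtain ⟨m, hm⟩ := hpoly x ⟨a, ha⟩ ⟨b, hb⟩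
  refine ⟨m, hm.1 (Set.mem_insert _ _), hm.1 (Set.mem_insert_of_mem _ rfl), fun c hca hcb => ?_⟩
  refine hm.2 (show (⟨c, hca.trans ha⟩ : Set.Iic x) ∈ _ from ?_)
  rintro _ (rfl | rfl)
  · exact hca
  · exact hcb

/-- The meet of `y` and `z` below `x` still has all of `S` among its vertices, so minimality of `y`
makes it equal to `y`. The common upper bound `x` is what provides the meet. -/
theorem Carries.le_of_subset (hpoly : IsPolyhedral P) {S : Set P} {x y z : P} (hy : Carries y S)
    (hyx : y ≤ x) (hzx : z ≤ x) (hz : S ⊆ vertexSet z) : y ≤ z := by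
  obtain ⟨m, hmy, hmz, hm⟩ := hpoly.exists_inf hyx hzx
  rcases hmy.eq_or_lt with rfl | h
  · exact hmz
  · exact (hy.2 m h fun v hv => ⟨(hz hv).1, hm v (hy.1 hv).2 (hz hv).2⟩).elim

theorem Carries.eq (hpoly : IsPolyhedral P) {S : Set P} {x y z : P} (hy : Carries y S)
    (hz : Carries z S) (hyx : y ≤ x) (hzx : z ≤ x) : y = z :=
  (hy.le_of_subset hpoly hyx hzx hz.1).antisymm (hz.le_of_subset hpoly hzx hyx hy.1)

theorem exists_carries_le [Finite P] {S : Set P} {x : P} (hS : S ⊆ vertexSet x) :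
    ∃ y ≤ x, Carries y S := by
  obtain ⟨y, hyx, hy⟩ := (Set.toFinite {z : P | S ⊆ vertexSet z}).exists_le_minimal hS
  exact ⟨y, hyx, hy.1, fun z hz h => hz.not_ge (hy.2 h hz.le)⟩

/-- Equal vertex sets make the nested down-sets of `x` and `y` isomorphic, and nested finite sets of
equal size coincide. -/
theorem IsRegular.eq_of_vertexSet_subset [Finite P] (hreg : IsRegular P) {x y : P} (hxy : x ≤ y)
    (h : vertexSet y ⊆ vertexSet x) : x = y := by
  have hv : vertexSet x = vertexSet y := (vertexSet_mono hxy).antisymm h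
  obtain ⟨e⟩ := hreg x y (by rw [numVertices, numVertices, hv])
  have hcard : (Set.Iic y).ncard ≤ (Set.Iic x).ncard := (Nat.card_congr e.toEquiv).ge
  have := Set.eq_of_subset_of_ncard_le (Set.Iic_subset_Iic.2 hxy) hcard
  exact Set.Iic_injective this

theorem IsRegular.carries_vertexSet [Finite P] (hreg : IsRegular P) (x : P) :
    Carries x (vertexSet x) :=
  ⟨subset_rfl, fun _ hz h => hz.ne (hreg.eq_of_vertexSet_subset hz.le h)⟩

theorem vertexSet_bot : vertexSet (⊥ : P) = ∅ := by
  ext v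
  simp only [vertexSet, Set.mem_ofPred_eq, Set.mem_empty_iff_false, iff_false, le_bot_iff]
  rintro ⟨h, rfl⟩
  exact h.1 rfl

theorem vertexSet_of_isAtom {v : P} (hv : IsAtom v) : vertexSet v = {v} := by
  ext w
  simp only [vertexSet, Set.mem_ofPred_eq, Set.mem_singleton_iff]
  exact ⟨fun h => (hv.le_iff.1 h.2).resolve_left h.1.1, by rintro rfl; exact ⟨hv, le_rfl⟩⟩

/-- The number of sets of `i + 1` vertices carried by `x`. -/
noncomputable def carriedCard (x : P) (i : ℤ) : ℕ :=
  Nat.card {S : Set P // Carries x S ∧ (S.ncard : ℤ) = i + 1}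

theorem Carries.ncard_le [Finite P] {x : P} {S : Set P} (h : Carries x S) :
    S.ncard ≤ numVertices x :=
  Set.ncard_le_ncard h.1 (Set.toFinite _)

theorem carriedCard_eq_zero_of_lt [Finite P] {x : P} {i : ℤ} (h : (numVertices x : ℤ) < i + 1) :
    carriedCard x i = 0 := by
  rw [carriedCard, Nat.card_eq_zero]
  refine Or.inl ⟨fun S => ?_⟩
  have := S.2.1.ncard_le
  have := S.2.2
  omega

theorem carriedCard_eq_one [Finite P] (hreg : IsRegular P) {x : P} {i : ℤ}
    (h : (numVertices x : ℤ) = i + 1) : carriedCard x i = 1 := by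
  rw [carriedCard, Nat.card_eq_one_iff_unique]
  refine ⟨⟨fun S T => Subtype.ext ?_⟩, ⟨⟨vertexSet x, hreg.carries_vertexSet x, h⟩⟩⟩
  have key : ∀ S : {S : Set P // Carries x S ∧ (S.ncard : ℤ) = i + 1}, S.1 = vertexSet x := by
    intro S
    refine Set.eq_of_subset_of_ncard_le S.2.1.1 ?_ (Set.toFinite _)
    have := S.2.2
    unfold numVertices at h
    omega
  rw [key S, key T]

/-- The empty set is carried only by `⊥`, and a single vertex only by itself. This justifies the
convention `ν_{i,k} = 0` for `i ≤ 0`. -/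
theorem carriedCard_eq_zero_of_nonpos [Finite P] {x : P} {i : ℤ} (hi : i ≤ 0)
    (h : i + 1 < (numVertices x : ℤ)) : carriedCard x i = 0 := by
  rw [carriedCard, Nat.card_eq_zero]
  refine Or.inl ⟨fun ⟨S, hS, hc⟩ => ?_⟩
  have hc' : S.ncard ≤ 1 := by omega
  have hx : ∀ z : P, S ⊆ vertexSet z → z ≤ x → z = x := fun z hz hzx =>
    hzx.eq_of_not_lt fun hlt => hS.2 z hlt hz
  rcases Set.ncard_le_one_iff_subsingleton.1 hc' |>.eq_empty_or_singleton
    with rfl | ⟨v, rfl⟩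
  · rw [← hx ⊥ (Set.empty_subset _) bot_le, numVertices, vertexSet_bot] at h
    simp at h hc
    omega
  · have hv := hS.1 rfl
    rw [← hx v (by rw [vertexSet_of_isAtom hv.1]) hv.2, numVertices,
      vertexSet_of_isAtom hv.1] at h
    simp at h hc
    omega

theorem vertexSet_orderIso {Q : Type*} [PartialOrder Q] [OrderBot Q] (e : P ≃o Q) (x : P) :
    vertexSet (e x) = e '' vertexSet x := by
  ext v
  obtain ⟨w, rfl⟩ := e.surjective v
  simp [vertexSet]

theorem carries_orderIso_image {Q : Type*} [PartialOrder Q] [OrderBot Q] (e : P ≃o Q) (x : P)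
    (S : Set P) : Carries (e x) (e '' S) ↔ Carries x S := by
  unfold Carries
  rw [vertexSet_orderIso, Set.image_subset_image_iff e.injective]
  refine and_congr_right fun _ => ⟨fun h z hz hS => h (e z) (by simpa using hz) ?_, fun h z => ?_⟩
  · rw [vertexSet_orderIso]
    exact Set.image_mono hS
  · obtain ⟨w, rfl⟩ := e.surjective z
    rw [vertexSet_orderIso, Set.image_subset_image_iff e.injective, e.lt_iff_lt]
    exact h w

theorem carriedCard_orderIso {Q : Type*} [PartialOrder Q] [OrderBot Q] (e : P ≃o Q) (x : P)
    (i : ℤ) : carriedCard (e x) i = carriedCard x i := by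
  refine (Nat.card_congr ((Equiv.Set.congr e.toEquiv).subtypeEquiv fun S => ?_)).symm
  change _ ↔ Carries (e x) (e '' S) ∧ ((e '' S).ncard : ℤ) = i + 1
  rw [carries_orderIso_image, Set.ncard_image_of_injective _ e.injective]

theorem vertexSet_image_val {x : P} (y : Set.Iic x) :
    Subtype.val '' vertexSet y = vertexSet (y : P) := by
  ext v
  simp only [vertexSet, Set.mem_image, Set.mem_ofPred_eq, Subtype.exists, Set.mem_Iic,
    exists_and_right, exists_eq_right]
  constructor
  · rintro ⟨hvx, ha, hle⟩
    exact ⟨ha.of_isAtom_coe_Iic, hle⟩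
  · rintro ⟨ha, hle⟩
    exact ⟨hle.trans y.2, ha.Iic (hle.trans y.2), hle⟩

theorem carries_image_val {x : P} (T : Set (Set.Iic x)) :
    Carries x (Subtype.val '' T) ↔ Carries (⊤ : Set.Iic x) T := by
  have key : ∀ y : Set.Iic x, Subtype.val '' T ⊆ vertexSet (y : P) ↔ T ⊆ vertexSet y := fun y => by
    rw [← vertexSet_image_val, Set.image_subset_image_iff Subtype.val_injective]
  refine and_congr (key ⊤) ⟨fun h z hz hT => h z hz ((key z).2 hT), fun h z hz hT => ?_⟩
  exact h ⟨z, hz.le⟩ hz ((key ⟨z, hz.le⟩).1 hT)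

theorem carriedCard_top (x : P) (i : ℤ) : carriedCard (⊤ : Set.Iic x) i = carriedCard x i := by
  refine Nat.card_congr (Equiv.ofBijective
    (fun T => ⟨Subtype.val '' T.1, (carries_image_val _).2 T.2.1, ?_⟩) ⟨fun T T' h => ?_, fun S => ?_⟩)
  · rw [Set.ncard_image_of_injective _ Subtype.val_injective]
    exact T.2.2
  · exact Subtype.ext (Set.image_injective.2 Subtype.val_injective (congrArg Subtype.val h))
  · have hS : Subtype.val '' (Subtype.val ⁻¹' S.1 : Set (Set.Iic x)) = S.1 := by
      rw [Subtype.image_preimage_coe, Set.inter_eq_right]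
      exact fun v hv => (S.2.1.1 hv).2
    refine ⟨⟨Subtype.val ⁻¹' S.1, (carries_image_val _).1 (hS.symm ▸ S.2.1), ?_⟩, Subtype.ext hS⟩
    rw [← Set.ncard_image_of_injective _ Subtype.val_injective, hS]
    exact S.2.2

/-- The generating relation never changes the set component, so that component descends to the
quotient. Counting classes `[⊤, S]` thus amounts to counting sets `S`. -/
theorem SimplicialTransform.mk_injective {x : P} {S T : Set P} {hS : S ⊆ vertexSet x}
    {hT : T ⊆ vertexSet x} (h : mk x S hS = mk x T hT) : S = T :=
  congrArg (Quot.lift (fun p : FacePair P => p.1.2) fun _ _ h => h.1) h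

theorem nuAt_eq_carriedCard (x : P) (i : ℤ) : nuAt x i = carriedCard x i := by
  rw [← carriedCard_top]
  refine (Nat.card_congr (Equiv.ofBijective (fun S => ⟨SimplicialTransform.mk ⊤ S.1 S.2.1.1,
    S.1, S.2.1.1, rfl, S.2.2, fun ⟨y, hy, h⟩ => S.2.1.2 y hy h⟩) ⟨fun S T h => ?_, ?_⟩)).symm
  · exact Subtype.ext (SimplicialTransform.mk_injective (congrArg Subtype.val h))
  · rintro ⟨_, S, hS, rfl, hc, h⟩
    exact ⟨⟨S, ⟨hS, fun y hy hSy => h ⟨y, hy, hSy⟩⟩, hc⟩, rfl⟩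

theorem IsRegular.carriedCard_congr (hreg : IsRegular P) {x y : P}
    (h : numVertices x = numVertices y) (i : ℤ) : carriedCard x i = carriedCard y i := by
  obtain ⟨e⟩ := hreg x y h
  rw [← carriedCard_top, ← carriedCard_top y, ← carriedCard_orderIso e, map_top]

theorem IsRegular.carriedCard_eq_nu [Finite P] (hreg : IsRegular P) {x : P} {i j : ℤ}
    (hx : (numVertices x : ℤ) = j + 1) (hij : i < j) : carriedCard x i = nu P i j := by
  by_cases hi : 1 ≤ i
  · have h : 1 ≤ i ∧ i < j ∧ ∃ x : P, (numVertices x : ℤ) = j + 1 := ⟨hi, hij, x, hx⟩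
    rw [nu, dif_pos h, nuAt_eq_carriedCard]
    refine hreg.carriedCard_congr ?_ i
    have := h.2.2.choose_spec
    omega
  · rw [nu, dif_neg fun h => hi h.1]
    exact carriedCard_eq_zero_of_nonpos (by omega) (by omega)

end Carriers

/-! ### The limit condition read on coefficients. -/

section FaceRing

open MvPolynomial

variable {k : Type*} [CommRing k] {P : Type*} [PartialOrder P] [OrderBot P]

theorem restrict_eq_killCompl {x y : P} (h : x ≤ y) :
    restrict k x y = killCompl (Set.inclusion_injective (vertexSet_mono h)) := by
  refine algHom_ext fun v => ?_
  simp only [restrict, killCompl, aeval_X]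
  by_cases hv : (v : P) ∈ vertexSet x
  · have hr : v ∈ Set.range (Set.inclusion (vertexSet_mono h)) := ⟨⟨v, hv⟩, rfl⟩
    rw [dif_pos hv, dif_pos hr]
    congr 1
    rw [Equiv.eq_symm_apply]
    rfl
  · rw [dif_neg hv, dif_neg]
    rintro ⟨w, rfl⟩
    exact hv w.2

theorem coeff_rename_val_of_not_subset {x : P} {m : P →₀ ℕ}
    (hm : ¬ (m.support : Set P) ⊆ vertexSet x) (q : MvPolynomial (vertexSet x) k) :
    coeff m (rename Subtype.val q) = 0 := by
  refine coeff_rename_eq_zero _ _ _ fun u hu => (hm ?_).elim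
  classical
  rw [← hu]
  intro v hv
  obtain ⟨w, -, rfl⟩ := Finset.mem_image.1 (Finsupp.mapDomain_support hv)
  exact w.2

theorem mapDomain_val_comapDomain {α : Type*} {s : Set α} {m : α →₀ ℕ}
    (hm : (m.support : Set α) ⊆ s) :
    (m.comapDomain (Subtype.val : s → α) Subtype.val_injective.injOn).mapDomain Subtype.val = m :=
  Finsupp.mapDomain_comapDomain _ Subtype.val_injective _ (by simpa using hm)

/-- Renaming into variables indexed by all of `P` lets components over different vertex sets be
compared at one exponent `m`. -/
theorem coeff_rename_restrict {x y : P} (h : x ≤ y) {m : P →₀ ℕ}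
    (hm : (m.support : Set P) ⊆ vertexSet x) (q : MvPolynomial (vertexSet y) k) :
    coeff m (rename Subtype.val (restrict k x y q)) = coeff m (rename Subtype.val q) := by
  rw [← mapDomain_val_comapDomain hm, coeff_rename_mapDomain _ Subtype.val_injective,
    restrict_eq_killCompl h, coeff_killCompl,
    ← coeff_rename_mapDomain _ Subtype.val_injective, ← Finsupp.mapDomain_comp]
  rfl

theorem ext_of_coeff_rename {x : P} {p q : MvPolynomial (vertexSet x) k}
    (h : ∀ m : P →₀ ℕ, (m.support : Set P) ⊆ vertexSet x →
      coeff m (rename Subtype.val p) = coeff m (rename Subtype.val q)) : p = q := by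
  refine rename_injective _ Subtype.val_injective (MvPolynomial.ext _ _ fun m => ?_)
  by_cases hm : (m.support : Set P) ⊆ vertexSet x
  · exact h m hm
  · rw [coeff_rename_val_of_not_subset hm, coeff_rename_val_of_not_subset hm]

theorem mem_stanleyReisner_iff {u : (x : P) → MvPolynomial (vertexSet x) k} :
    u ∈ stanleyReisner k P ↔ ∀ x y : P, x ≤ y → ∀ m : P →₀ ℕ, (m.support : Set P) ⊆ vertexSet x →
      coeff m (rename Subtype.val (u y)) = coeff m (rename Subtype.val (u x)) := by
  refine forall₃_congr fun x y h => ⟨fun hu m hm => ?_, fun hu => ?_⟩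
  · rw [← hu, coeff_rename_restrict h hm]
  · exact ext_of_coeff_rename fun m hm => by rw [coeff_rename_restrict h hm, hu m hm]

/-! ### The grading -/

theorem coeff_rename_homogeneousComponent {x : P} (n : ℕ) (q : MvPolynomial (vertexSet x) k)
    {m : P →₀ ℕ} (hm : (m.support : Set P) ⊆ vertexSet x) :
    coeff m (rename Subtype.val (homogeneousComponent n q)) =
      if m.degree = n then coeff m (rename Subtype.val q) else 0 := by
  have hdeg : m.degree = (m.comapDomain (Subtype.val : vertexSet x → P)
      Subtype.val_injective.injOn).degree := by
    conv_lhs => rw [← mapDomain_val_comapDomain hm]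
    exact Finsupp.degree_mapDomain _ _
  rw [hdeg]
  conv_lhs => rw [← mapDomain_val_comapDomain hm]
  conv_rhs => rw [← mapDomain_val_comapDomain hm]
  rw [coeff_rename_mapDomain _ Subtype.val_injective,
    coeff_rename_mapDomain _ Subtype.val_injective, coeff_homogeneousComponent,
    mapDomain_val_comapDomain hm]

variable (k P) in
/-- The degree `n` component of an element of `k[P]`. -/
noncomputable def component (n : ℕ) : stanleyReisner k P →ₗ[k] stanleyReisner k P where
  toFun u := ⟨fun x => homogeneousComponent n (u.1 x), mem_stanleyReisner_iff.2
    fun x y h m hm => by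
      rw [coeff_rename_homogeneousComponent n _ hm,
        coeff_rename_homogeneousComponent n _ (hm.trans (vertexSet_mono h)),
        mem_stanleyReisner_iff.1 u.2 x y h m hm]⟩
  map_add' u v := Subtype.ext (funext fun x => map_add (homogeneousComponent n) _ _)
  map_smul' c u := Subtype.ext (funext fun x => map_smul (homogeneousComponent n) _ _)

theorem component_mem (n : ℕ) (u : stanleyReisner k P) : component k P n u ∈ degreePart k P n :=
  fun x => homogeneousComponent_isHomogeneous n (u.1 x)

theorem component_of_mem {n j : ℕ} {u : stanleyReisner k P} (hu : u ∈ degreePart k P j) :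
    component k P n u = if n = j then u else 0 := by
  refine Subtype.ext (funext fun x => ?_)
  refine (homogeneousComponent_of_mem (m := n) (hu x)).trans ?_
  split_ifs <;> rfl

theorem sum_component [Finite P] (u : stanleyReisner k P) :
    ∃ N, ∑ n ∈ Finset.range N, component k P n u = u := by
  have := Fintype.ofFinite P
  refine ⟨Finset.univ.sup (fun x => (u.1 x).totalDegree) + 1, Subtype.ext (funext fun x => ?_)⟩
  rw [AddSubmonoidClass.coe_finsetSum, Finset.sum_apply]
  have hx : (u.1 x).totalDegree ≤ Finset.univ.sup (fun x => (u.1 x).totalDegree) :=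
    Finset.le_sup (f := fun x => (u.1 x).totalDegree) (Finset.mem_univ x)
  conv_rhs => rw [← sum_homogeneousComponent (u.1 x)]
  refine (Finset.sum_subset (Finset.range_mono (by omega)) fun n _ hn => ?_).symm
  exact homogeneousComponent_eq_zero _ _ (by simpa using hn)

variable (k P) in
theorem gradedMonoid_degreePart : SetLike.GradedMonoid (degreePart k P) where
  one_mem _ := isHomogeneous_one _ _
  mul_mem _ _ _ _ hu hv x := (hu x).mul (hv x)

variable (k P) in
theorem isInternal_degreePart [Finite P] : DirectSum.IsInternal (degreePart k P) := by
  constructor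
  · intro f g hfg
    refine DFinsupp.ext fun n => Subtype.ext ?_
    -- Taking the `n`-th homogeneous component recovers the `n`-th summand, whence injectivity of
    -- the sum map.
    have key : component k P n ∘ₗ DirectSum.coeLinearMap (degreePart k P) =
        (degreePart k P n).subtype ∘ₗ DirectSum.component k ℕ (fun i => degreePart k P i) n := by
      refine DirectSum.linearMap_ext _ fun j => LinearMap.ext fun u => ?_
      simp only [LinearMap.comp_apply, DirectSum.coeLinearMap_lof, component_of_mem u.2,
        Submodule.subtype_apply]
      split_ifs with h
      · subst h
        rw [DirectSum.component.lof_self]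
      · rw [DirectSum.component.of, dif_neg (Ne.symm h)]
        rfl
    have hf := LinearMap.congr_fun key f
    have hg := LinearMap.congr_fun key g
    exact hf.symm.trans ((congrArg (component k P n) hfg).trans hg)
  · intro u
    obtain ⟨N, hN⟩ := sum_component u
    refine ⟨∑ n ∈ Finset.range N,
      DirectSum.of (fun i => degreePart k P i) n ⟨component k P n u, component_mem n u⟩, ?_⟩
    rw [map_sum]
    simpa using hN

/-! ### Monomial families -/

open scoped Classical in
variable (k) in
/-- The family that is the monomial `m` at the objects above `y`, and `0` elsewhere. -/
noncomputable def monomialFamily (y : P) (m : P →₀ ℕ) (x : P) : MvPolynomial (vertexSet x) k :=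
  if y ≤ x then monomial (m.comapDomain Subtype.val Subtype.val_injective.injOn) 1 else 0

open scoped Classical in
theorem coeff_rename_monomialFamily {y : P} {m : P →₀ ℕ} (hm : (m.support : Set P) ⊆ vertexSet y)
    (x : P) (m' : P →₀ ℕ) :
    coeff m' (rename Subtype.val (monomialFamily k y m x)) = if y ≤ x ∧ m = m' then 1 else 0 := by
  unfold monomialFamily
  by_cases h : y ≤ x
  · rw [if_pos h, rename_monomial, mapDomain_val_comapDomain (hm.trans (vertexSet_mono h)),
      coeff_monomial]
    simp [h]
  · simp [h]

/-- Compatibility could fail only for `x ≤ x'` with `y ≤ x'`, the support of `m` inside `V(x)`, and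
`y ≰ x`; `Carries.le_of_subset` excludes this. -/
theorem monomialFamily_mem (hpoly : IsPolyhedral P) {y : P} {m : P →₀ ℕ}
    (hm : Carries y m.support) : monomialFamily k y m ∈ stanleyReisner k P := by
  classical
  refine mem_stanleyReisner_iff.2 fun x x' h m' hm' => ?_
  rw [coeff_rename_monomialFamily hm.1, coeff_rename_monomialFamily hm.1]
  refine if_congr ⟨?_, fun h' => ⟨h'.1.trans h, h'.2⟩⟩ rfl rfl
  rintro ⟨hy, rfl⟩
  exact ⟨hm.le_of_subset hpoly hy h hm', rfl⟩

theorem monomialFamily_isHomogeneous {y : P} {m : P →₀ ℕ} (hm : (m.support : Set P) ⊆ vertexSet y)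
    (x : P) : (monomialFamily k y m x).IsHomogeneous m.degree := by
  unfold monomialFamily
  split_ifs with h
  · refine isHomogeneous_monomial _ ?_
    conv_rhs => rw [← mapDomain_val_comapDomain (hm.trans (vertexSet_mono h))]
    exact (Finsupp.degree_mapDomain _ _).symm
  · exact isHomogeneous_zero _ _ _

/-- The exponent of the product of the vertices of `x`. -/
noncomputable def vertexExponent [Finite P] (x : P) : P →₀ ℕ :=
  Finsupp.indicator (Set.toFinite (vertexSet x)).toFinset fun _ _ => 1

theorem vertexExponent_apply_of_mem [Finite P] {x v : P} (hv : v ∈ vertexSet x) :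
    vertexExponent x v = 1 := by
  rw [vertexExponent, Finsupp.indicator_of_mem ((Set.toFinite _).mem_toFinset.2 hv)]

theorem support_vertexExponent [Finite P] (x : P) :
    (vertexExponent x).support = (Set.toFinite (vertexSet x)).toFinset := by
  classical
  ext v
  simp [vertexExponent, Finsupp.indicator_apply]

theorem coe_support_vertexExponent [Finite P] (x : P) :
    ((vertexExponent x).support : Set P) = vertexSet x := by
  rw [support_vertexExponent, Set.Finite.coe_toFinset]

theorem degree_vertexExponent [Finite P] (x : P) : (vertexExponent x).degree = numVertices x := by
  rw [numVertices, Set.ncard_eq_toFinset_card _ (Set.toFinite _), Finset.card_eq_sum_ones,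
    Finsupp.degree_apply, support_vertexExponent]
  exact Finset.sum_congr rfl fun v hv =>
    vertexExponent_apply_of_mem ((Set.toFinite _).mem_toFinset.1 hv)

variable (k) in
theorem objectFamily_eq_monomialFamily [Finite P] (x : P) :
    objectFamily k x = monomialFamily k x (vertexExponent x) := by
  classical
  have := Fintype.ofFinite (vertexSet x)
  funext y
  unfold objectFamily monomialFamily
  split_ifs with h
  · refine rename_injective _ Subtype.val_injective ?_
    rw [rename_monomial, mapDomain_val_comapDomain
      ((coe_support_vertexExponent x).subset.trans (vertexSet_mono h)),
      finprod_eq_prod_of_fintype, map_prod, monomial_eq, C_1, one_mul, Finsupp.prod,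
      support_vertexExponent, Finset.prod_subtype (p := (· ∈ vertexSet x)) _ (by simp)]
    refine Finset.prod_congr rfl fun v _ => ?_
    rw [rename_X, vertexExponent_apply_of_mem v.2, pow_one]
  · rfl

variable (k) in
theorem exists_mem_degreePart_eq_objectFamily [Finite P] (hpoly : IsPolyhedral P)
    (hreg : IsRegular P) (x : P) :
    ∃ u ∈ degreePart k P (numVertices x), u.1 = objectFamily k x := by
  have hc : Carries x (vertexExponent x).support :=
    (coe_support_vertexExponent x).symm ▸ hreg.carries_vertexSet x
  rw [objectFamily_eq_monomialFamily, ← degree_vertexExponent]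
  exact ⟨⟨_, monomialFamily_mem hpoly hc⟩, fun y => monomialFamily_isHomogeneous hc.1 y, rfl⟩

/-! ### A basis of each degree part. -/

variable (P) in
/-- The pairs of a monomial of degree `n` and an object carrying its support. -/
abbrev CarriedMonomial (n : ℕ) : Type _ :=
  {q : P × (P →₀ ℕ) // Carries q.1 (q.2.support : Set P) ∧ q.2.degree = n}

instance [Finite P] (n : ℕ) : Finite (CarriedMonomial P n) :=
  ((Set.finite_univ.prod (Finsupp.finite_of_degree_eq n)).subset
    fun _ hq => ⟨Set.mem_univ _, hq.2⟩ : {_q : P × (P →₀ ℕ) | _}.Finite)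

variable (k P) in
/-- The coefficients of an element of `k[P]_n` at the carried monomials. -/
noncomputable def carriedCoeff (n : ℕ) : degreePart k P n →ₗ[k] (CarriedMonomial P n → k) where
  toFun u q := coeff q.1.2 (rename Subtype.val (u.1.1 q.1.1))
  map_add' u v := by ext; simp
  map_smul' c u := by ext; simp

theorem carriedCoeff_injective [Finite P] (n : ℕ) :
    Function.Injective (carriedCoeff k P n) := by
  refine (injective_iff_map_eq_zero _).2 fun u hu => ?_
  refine Subtype.ext (Subtype.ext (funext fun x => ext_of_coeff_rename fun m hm => ?_))
  change _ = coeff m (rename Subtype.val 0)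
  rw [map_zero, coeff_zero]
  -- Compatibility moves the coefficient from `x` down to the carrier, where it vanishes by
  -- assumption or for degree reasons.
  obtain ⟨y, hyx, hy⟩ := exists_carries_le hm
  rw [mem_stanleyReisner_iff.1 u.1.2 y x hyx m hy.1]
  by_cases hn : m.degree = n
  · exact congrFun hu ⟨(y, m), hy, hn⟩
  · exact ((u.2 y).rename_isHomogeneous).coeff_eq_zero hn

theorem carriedCoeff_surjective [Finite P] (hpoly : IsPolyhedral P) (n : ℕ) :
    Function.Surjective (carriedCoeff k P n) := by
  classical
  have := Fintype.ofFinite (CarriedMonomial P n)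
  intro c
  let b : CarriedMonomial P n → degreePart k P n := fun q =>
    ⟨⟨monomialFamily k q.1.1 q.1.2, monomialFamily_mem hpoly q.2.1⟩,
      fun x => by
        have := monomialFamily_isHomogeneous (k := k) q.2.1.1 x
        rwa [q.2.2] at this⟩
  -- The monomial families are dual to the coefficient functionals: comparable carriers of the same
  -- support coincide.
  have hb : ∀ q q', carriedCoeff k P n (b q) q' = if q' = q then 1 else 0 := by
    intro q q'
    change coeff q'.1.2 (rename Subtype.val (monomialFamily k q.1.1 q.1.2 q'.1.1)) = _
    rw [coeff_rename_monomialFamily q.2.1.1]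
    refine if_congr ⟨fun h => Subtype.ext (Prod.ext ?_ h.2.symm), ?_⟩ rfl rfl
    · have h2 := q'.2.1
      rw [← h.2] at h2
      exact (q.2.1.eq hpoly h2 h.1 le_rfl).symm
    · rintro rfl
      exact ⟨le_rfl, rfl⟩
  refine ⟨∑ q, c q • b q, funext fun q' => ?_⟩
  simp [map_sum, Finset.sum_apply, hb]

/-- `k[P]_n` is free on the carried monomials of degree `n`. -/
noncomputable def degreePartEquiv [Finite P] (hpoly : IsPolyhedral P) (n : ℕ) :
    degreePart k P n ≃ₗ[k] (CarriedMonomial P n → k) :=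
  LinearEquiv.ofBijective (carriedCoeff k P n)
    ⟨carriedCoeff_injective n, carriedCoeff_surjective hpoly n⟩

variable (k) in
theorem free_degreePart [Finite P] (hpoly : IsPolyhedral P) (n : ℕ) :
    Module.Free k (degreePart k P n) :=
  Module.Free.of_equiv (degreePartEquiv hpoly n).symm

variable (k) in
theorem finite_degreePart [Finite P] (hpoly : IsPolyhedral P) (n : ℕ) :
    Module.Finite k (degreePart k P n) :=
  Module.Finite.equiv (degreePartEquiv hpoly n).symm

variable (k) in
theorem finrank_degreePart [Nontrivial k] [Finite P] (hpoly : IsPolyhedral P) (n : ℕ) :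
    Module.finrank k (degreePart k P n) = Nat.card (CarriedMonomial P n) := by
  have := Fintype.ofFinite (CarriedMonomial P n)
  rw [(degreePartEquiv hpoly n).finrank_eq, Module.finrank_fintype_fun_eq_card,
    Nat.card_eq_fintype_card]

end FaceRing

/-! ### Generating functions and the count of carried sets. -/

section Series

/-- `t^s / (1-t)^s`. -/
noncomputable def orthantSeries (s : ℕ) : PowerSeries ℚ :=
  PowerSeries.X ^ s * ((1 - PowerSeries.X) ^ s)⁻¹

theorem inv_one_sub_X :
    (1 - PowerSeries.X : PowerSeries ℚ)⁻¹ = PowerSeries.mk fun _ => 1 := by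
  rw [PowerSeries.inv_eq_iff_mul_eq_one (by simp)]
  exact PowerSeries.mk_one_mul_one_sub_eq_one ℚ

theorem orthantSeries_eq_pow (s : ℕ) :
    orthantSeries s = (PowerSeries.X * PowerSeries.mk fun _ => 1) ^ s := by
  rw [mul_pow, ← inv_one_sub_X, orthantSeries]
  congr 1
  rw [PowerSeries.inv_eq_iff_mul_eq_one (by simp), ← mul_pow, PowerSeries.inv_mul_cancel _ (by simp),
    one_pow]

/-- Each element of `S` contributes a factor `t/(1-t) = t + t² + ⋯`, which records a positive
exponent. -/
theorem coeff_orthantSeries {α : Type*} [Finite α] (S : Set α) (n : ℕ) :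
    PowerSeries.coeff n (orthantSeries S.ncard) =
      Nat.card {m : α →₀ ℕ // (m.support : Set α) = S ∧ m.degree = n} := by
  classical
  have hX : ∀ j : ℕ, PowerSeries.coeff j (PowerSeries.X * PowerSeries.mk fun _ => (1 : ℚ)) =
      if j = 0 then 0 else 1 := by
    rintro (_ | j)
    · simp
    · simp [PowerSeries.coeff_succ_X_mul]
  have hS := Set.toFinite S
  rw [orthantSeries_eq_pow, Set.ncard_eq_toFinset_card S hS, ← Finset.prod_const,
    PowerSeries.coeff_prod]
  simp only [hX]
  -- The exponents in the expanded product are already supported in `S`; the surviving terms are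
  -- those with support all of `S`.
  have hprod : ∀ l : α →₀ ℕ, (∏ i ∈ hS.toFinset, if l i = 0 then (0 : ℚ) else 1) =
      if hS.toFinset ⊆ l.support then 1 else 0 := by
    intro l
    split_ifs with h
    · exact Finset.prod_eq_one fun i hi => if_neg (Finsupp.mem_support_iff.1 (h hi))
    · obtain ⟨i, hi, hl⟩ := Finset.not_subset.1 h
      exact Finset.prod_eq_zero hi (if_pos (Finsupp.notMem_support_iff.1 hl))
  simp only [hprod, Finset.sum_boole]
  rw [Nat.subtype_card]
  intro l
  have hl : (l.support : Set α) = S ↔ l.support = hS.toFinset := by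
    rw [← Finset.coe_inj, hS.coe_toFinset]
  rw [Finset.mem_filter, Finset.mem_finsuppAntidiag', hl]
  constructor
  · rintro ⟨⟨h1, h2⟩, h3⟩
    exact ⟨h2.antisymm h3, h1⟩
  · rintro ⟨h1, h2⟩
    exact ⟨⟨h2, h1.le⟩, h1.ge⟩

variable {P : Type*} [PartialOrder P] [OrderBot P]

theorem numVertices_le_dim [Finite P] (x : P) : (numVertices x : ℤ) ≤ dim P + 1 := by
  have : numVertices x ≤ ⨆ x : P, numVertices x :=
    le_ciSup (Set.finite_range (numVertices (P := P))).bddAbove x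
  unfold dim
  omega

open scoped Classical in
theorem sum_orthantSeries_carried [Fintype P] (y : P) [Fintype {S : Set P // Carries y S}] :
    ∑ S : {S : Set P // Carries y S}, orthantSeries S.1.ncard =
      ∑ i ∈ Finset.Icc (-1) (dim P),
        PowerSeries.C (carriedCard y i : ℚ) * orthantSeries (i + 1).toNat := by
  rw [← Finset.sum_fiberwise_of_maps_to (t := Finset.Icc (-1) (dim P))
    (g := fun S : {S : Set P // Carries y S} => (S.1.ncard : ℤ) - 1)]
  · refine Finset.sum_congr rfl fun i _ => ?_
    rw [Finset.sum_congr rfl (g := fun _ => orthantSeries (i + 1).toNat)]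
    · rw [Finset.sum_const, nsmul_eq_mul, map_natCast, carriedCard]
      congr 2
      rw [← Nat.card_congr (Equiv.subtypeSubtypeEquivSubtypeInter (Carries y)
        fun S => (S.ncard : ℤ) = i + 1), Nat.subtype_card]
      intro S
      simp [sub_eq_iff_eq_add]
    · intro S hS
      have := (Finset.mem_filter.1 hS).2
      congr 1
      omega
  · intro S _
    have := S.2.ncard_le
    have := numVertices_le_dim y
    rw [Finset.mem_Icc]
    omega

/-- Group the objects by `j = |V(y)| - 1`. The group `j = i` gives `f_i`, since such an object
carries only its full vertex set at that size; the groups `j < i` give nothing. -/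
theorem sum_carriedCard [Fintype P] (hreg : IsRegular P) {i : ℤ}
    (hi : i ∈ Finset.Icc (-1) (dim P)) :
    ∑ y : P, carriedCard y i =
      fNumber P i + ∑ j ∈ Finset.Icc (i + 1) (dim P), fNumber P j * nu P i j := by
  classical
  rw [← Finset.sum_fiberwise_of_maps_to (t := Finset.Icc (-1) (dim P))
    (g := fun y : P => (numVertices y : ℤ) - 1)]
  · have key : ∀ j, (∑ y : P with (numVertices y : ℤ) - 1 = j, carriedCard y i) =
        fNumber P j * if j = i then 1 else if i < j then nu P i j else 0 := by
      intro j
      have hcard : fNumber P j = (Finset.univ.filter fun y : P => (numVertices y : ℤ) - 1 = j).card :=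
        Nat.subtype_card _ fun y => by simp [sub_eq_iff_eq_add]
      rw [hcard, ← smul_eq_mul]
      refine Finset.sum_eq_card_nsmul fun y hy => ?_
      have hy' := (Finset.mem_filter.1 hy).2
      split_ifs with h h'
      · exact carriedCard_eq_one hreg (by omega)
      · exact hreg.carriedCard_eq_nu (by omega) h'
      · exact carriedCard_eq_zero_of_lt (by omega)
    simp only [key]
    rw [← Finset.add_sum_erase _ _ hi, if_pos rfl, mul_one]
    congr 1
    rw [Finset.mem_Icc] at hi
    refine (Finset.sum_subset_zero_on_sdiff (fun j hj => ?_) (fun j hj => ?_) fun j hj => ?_).symm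
    · simp only [Finset.mem_erase, Finset.mem_Icc] at hj ⊢
      omega
    · simp only [Finset.mem_sdiff, Finset.mem_erase, Finset.mem_Icc] at hj
      rw [if_neg (by omega), if_neg (by omega), mul_zero]
    · rw [Finset.mem_Icc] at hj
      rw [if_neg (by omega), if_pos (by omega)]
  · intro y _
    have := numVertices_le_dim y
    rw [Finset.mem_Icc]
    omega

end Series
-- Assembling the Poincaré series.
section Poincare

variable {P : Type*} [PartialOrder P] [OrderBot P]

theorem card_carriedMonomial [Fintype P] (n : ℕ) [∀ y : P, Fintype {S : Set P // Carries y S}] :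
    (Nat.card (CarriedMonomial P n) : ℚ) = PowerSeries.coeff n
      (∑ y : P, ∑ S : {S : Set P // Carries y S}, orthantSeries S.1.ncard) := by
  -- Carried monomials are sorted by carrier and then by exact support, so that
  -- `coeff_orthantSeries` counts each fibre.
  let e : CarriedMonomial P n ≃ Σ y : P, Σ S : {S : Set P // Carries y S},
      {m : P →₀ ℕ // (m.support : Set P) = S.1 ∧ m.degree = n} :=
    { toFun := fun q => ⟨q.1.1, ⟨q.1.2.support, q.2.1⟩, q.1.2, rfl, q.2.2⟩
      invFun := fun t => ⟨(t.1, t.2.2.1), t.2.2.2.1.symm ▸ t.2.1.2, t.2.2.2.2⟩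
      left_inv := fun _ => rfl
      right_inv := by
        rintro ⟨y, ⟨S, hS⟩, m, h, hm⟩
        obtain rfl : (m.support : Set P) = S := h
        rfl }
  have hfin : ∀ S : Set P, Finite {m : P →₀ ℕ // (m.support : Set P) = S ∧ m.degree = n} :=
    fun S => ((Finsupp.finite_of_degree_eq n).subset fun _ hm => hm.2 :
      {m : P →₀ ℕ | (m.support : Set P) = S ∧ m.degree = n}.Finite)
  rw [Nat.card_congr e, Nat.card_sigma]
  simp only [Nat.card_sigma, map_sum, Nat.cast_sum, coeff_orthantSeries]

theorem poincareSeries_eq_sum (k : Type*) [CommRing k] [Nontrivial k] [Finite P]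
    (hpoly : IsPolyhedral P) (hreg : IsRegular P) :
    poincareSeries k P = ∑ i ∈ Finset.Icc (-1) (dim P),
      PowerSeries.C ((fNumber P i : ℚ) +
        ∑ j ∈ Finset.Icc (i + 1) (dim P), (fNumber P j : ℚ) * (nu P i j : ℚ)) *
      orthantSeries (i + 1).toNat := by
  classical
  have := Fintype.ofFinite P
  have hS : poincareSeries k P =
      ∑ y : P, ∑ S : {S : Set P // Carries y S}, orthantSeries S.1.ncard := by
    ext n
    rw [poincareSeries, PowerSeries.coeff_mk, finrank_degreePart k hpoly, card_carriedMonomial]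
  rw [hS]
  simp only [sum_orthantSeries_carried]
  rw [Finset.sum_comm]
  refine Finset.sum_congr rfl fun i hi => ?_
  rw [← Finset.sum_mul, ← map_sum, ← Nat.cast_sum, sum_carriedCard hreg hi]
  push_cast
  rfl

end Poincare

end PolyhedralPoset

theorem mainTheorem12 (k : Type*) [CommRing k] [Nontrivial k]
    (P : Type*) [PartialOrder P] [OrderBot P] [Finite P]
    (hpoly : PolyhedralPoset.IsPolyhedral P) (hreg : PolyhedralPoset.IsRegular P) :
    SetLike.GradedMonoid (PolyhedralPoset.degreePart k P) ∧
    DirectSum.IsInternal (PolyhedralPoset.degreePart k P) ∧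
    (∀ x : P, ∃ u ∈ PolyhedralPoset.degreePart k P (PolyhedralPoset.numVertices x),
      u.1 = PolyhedralPoset.objectFamily k x) ∧
    (∀ n : ℕ, Module.Free k (PolyhedralPoset.degreePart k P n) ∧
      Module.Finite k (PolyhedralPoset.degreePart k P n)) ∧
    PolyhedralPoset.poincareSeries k P =
      ∑ i ∈ Finset.Icc (-1) (PolyhedralPoset.dim P),
        PowerSeries.C ((PolyhedralPoset.fNumber P i : ℚ) +
          ∑ j ∈ Finset.Icc (i + 1) (PolyhedralPoset.dim P),
            (PolyhedralPoset.fNumber P j : ℚ) * (PolyhedralPoset.nu P i j : ℚ)) *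
        (PowerSeries.X ^ (i + 1).toNat * ((1 - PowerSeries.X) ^ (i + 1).toNat)⁻¹) :=
  open PolyhedralPoset in
  ⟨gradedMonoid_degreePart k P, isInternal_degreePart k P,
    exists_mem_degreePart_eq_objectFamily k hpoly hreg,
    fun n => ⟨free_degreePart k hpoly n, finite_degreePart k hpoly n⟩,
    poincareSeries_eq_sum k hpoly hreg⟩
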